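/- **Conventions.** Let $G$ be a group. For a finite symmetrized generating set $\mathcal A=\mathcal A^{-1}$ of $G$ let $\Gamma(G,\mathcal A)$ be the Cayley graph, $d$ its path metric (the word metric on $G$), and $(x|y)_w=\frac12\bigl(d(x,w)+d(y,w)-d(x,y)\bigr)$ the Gromov product. The group $G$ is *hyperbolic* if it has a finite symmetrized generating set $\mathcal A$ and a constant $\delta\ge 0$ such that $(x|y)_w\ge\min\{(x|z)_w,(y|z)_w\}-\delta$ for all $x,y,z,w\in G$. A subset $Q\subseteq G$ is *quasiconvex* if, for some finite symmetrized generating set $\mathcal A$ of $G$ (in a hyperbolic group the choice is immaterial), there is $\eta\ge 0$ such that every geodesic path in $\Gamma(G,\mathcal A)$ joining two elements of $Q$ has all its vertices at distance at most $\eta$ from $Q$. The *profinite topology* on $G$ is the topology whose basic open sets are the cosets of the normal subgroups of finite index. A hyperbolic group $G$ is *GFERF* if every quasiconvex subgroup of $G$ is closed in the profinite topology of $G$. **Theorem.** Let $G_1$ and $G_2$ be GFERF hyperbolic groups. Then the free product $G=G_1*G_2$ is also a GFERF hyperbolic group; that is, $G$ is hyperbolic and every quasiconvex subgroup of $G$ is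 closed in the profinite topology of $G$. -/

import Mathlib

open scoped Pointwise Topology

/-- `A` is a finite symmetrized generating set of the group `G`. -/
structure IsFiniteSymmGenSet {G : Type*} [Group G] (A : Set G) : Prop where
  finite : A.Finite
  symm : A⁻¹ = A
  closure_eq_top : Subgroup.closure A = ⊤

/-- The word metric on `G` with respect to `A`: the path metric on the vertices of the (right)
Cayley graph, in which `u` and `u * a` are joined by an edge for `a ∈ A`. -/
noncomputable def wordDist {G : Type*} [Group G] (A : Set G) (x y : G) : ℝ :=
  ((SimpleGraph.mulCayley A).dist x y : ℝ)

/-- The Gromov product `(x|y)_w` with respect to the word metric. -/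
noncomputable def gromovProduct {G : Type*} [Group G] (A : Set G) (x y w : G) : ℝ :=
  (1 / 2) * (wordDist A x w + wordDist A y w - wordDist A x y)

/-- A group is (word) hyperbolic if it has a finite symmetrized generating set whose word metric
satisfies Gromov's inequality for some `δ ≥ 0`. (Every point of the geometric realization of the
Cayley graph is within `1/2` of a vertex, so asking for the inequality at all points of the
realization only changes the value of `δ`.) -/
def IsHyperbolicGroup (G : Type*) [Group G] : Prop :=
  ∃ A : Set G, IsFiniteSymmGenSet A ∧ ∃ δ : ℝ, 0 ≤ δ ∧ ∀ x y z w : G,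
    min (gromovProduct A x z w) (gromovProduct A y z w) - δ ≤ gromovProduct A x y w

/-- A subset `Q` of `G` is quasiconvex with respect to `A` if for some `η ≥ 0` every geodesic
(a path in the Cayley graph whose length is the distance of its endpoints) between two elements
of `Q` stays in the closed `η`-neighbourhood of `Q`. (Including the interior points of the edges
would only change the value of `η`.) -/
def IsQuasiconvexWith {G : Type*} [Group G] (A : Set G) (Q : Set G) : Prop :=
  ∃ η : ℝ, 0 ≤ η ∧ ∀ u ∈ Q, ∀ v ∈ Q, ∀ p : (SimpleGraph.mulCayley A).Walk u v,
    p.length = (SimpleGraph.mulCayley A).dist u v →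
      ∀ x ∈ p.support, ∃ q ∈ Q, wordDist A x q ≤ η

/-- A subset is quasiconvex if it is so with respect to a finite symmetrized generating set of `G`.
(In a hyperbolic group the choice of that set is immaterial.) -/
def IsQuasiconvex {G : Type*} [Group G] (Q : Set G) : Prop :=
  ∃ A : Set G, IsFiniteSymmGenSet A ∧ IsQuasiconvexWith A Q

/-- The profinite topology on `G`, generated by the cosets of the normal subgroups of finite
index. -/
abbrev profiniteTopology (G : Type*) [Group G] : TopologicalSpace G :=
  TopologicalSpace.generateFrom
    {U : Set G | ∃ N : Subgroup G, N.Normal ∧ N.FiniteIndex ∧ ∃ g : G, U = g • (N : Set G)}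

/-- A GFERF hyperbolic group: a hyperbolic group in which every quasiconvex subgroup is closed in
the profinite topology. -/
def IsGFERFHyperbolicGroup (G : Type*) [Group G] : Prop :=
  IsHyperbolicGroup G ∧
    ∀ H : Subgroup G, IsQuasiconvex (H : Set G) → IsClosed[profiniteTopology G] (H : Set G)

/-! Hyperbolicity of `G₁ * G₂` uses its tree-like structure. For the union of generating sets, both
factors embed isometrically, and a path leaving the set of points with a given projection to a
factor must pass through the projection point. Distances thus split at the projections, and the
four-point inequality reduces to that of the factors with the same δ (`fourPoint_coprodGenSet`).

For separability, let H be quasiconvex. It is finitely generated, and by stability of quasigeodesics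
its conjugates meet the factors in quasiconvex subgroups (`IsQuasiconvexWith.comap_conj`), closed by
hypothesis. These are the stabilizers for the factor actions on G/H. Closedness lets each factor
action be replaced by one of finite support that agrees with it on a prescribed finite set
(`exists_finite_support_action`). By the universal property the two replacements form an action of
G. If the finite set contains the trajectories of the base coset under generators of H and under
some g ∉ H, the new stabilizer of the base coset has finite index, contains H and omits g
(`isClosed_coprod_of_isClosed_stabilizer`). -/

/-! ### Lipschitz maps and geodesics in graphs -/

section Graph

variable {V W : Type*} {Γ : SimpleGraph V} {Γ' : SimpleGraph W}

theorem SimpleGraph.Connected.dist_le_mul_dist (hΓ : Γ.Connected) (hΓ' : Γ'.Connected) (f : V → W)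
    (L : ℕ) (hf : ∀ u v, Γ.Adj u v → Γ'.dist (f u) (f v) ≤ L) (u v : V) :
    Γ'.dist (f u) (f v) ≤ L * Γ.dist u v := by
  obtain ⟨p, hp⟩ := hΓ.exists_walk_length_eq_dist u v
  rw [← hp]
  clear hp
  induction p with
  | nil => simp
  | cons h p ih =>
    rw [SimpleGraph.Walk.length_cons, mul_add, mul_one, add_comm]
    exact hΓ'.dist_triangle.trans (add_le_add (hf _ _ h) ih)

theorem SimpleGraph.Walk.dist_getVert_le {u v : V} (p : Γ.Walk u v) {i j : ℕ} (hij : i ≤ j) :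
    Γ.dist (p.getVert i) (p.getVert j) ≤ j - i := by
  have h := (SimpleGraph.dist_le ((p.drop i).take (j - i))).trans
    (by simp : ((p.drop i).take (j - i)).length ≤ j - i)
  rwa [SimpleGraph.Walk.drop_getVert, Nat.add_sub_cancel' hij] at h

theorem SimpleGraph.Walk.dist_getVert_of_geodesic (hΓ : Γ.Connected) {u v : V} (p : Γ.Walk u v)
    (hp : p.length = Γ.dist u v) {i j : ℕ} (hij : i ≤ j) (hj : j ≤ p.length) :
    Γ.dist (p.getVert i) (p.getVert j) = j - i := by
  refine le_antisymm (p.dist_getVert_le hij) ?_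
  have h1 := p.dist_getVert_le (Nat.zero_le i)
  have h2 := p.dist_getVert_le hj
  rw [p.getVert_zero] at h1
  rw [p.getVert_length] at h2
  have h3 : Γ.dist u v ≤ Γ.dist u (p.getVert i) + Γ.dist (p.getVert i) v := hΓ.dist_triangle
  have h4 : Γ.dist (p.getVert i) v ≤
    Γ.dist (p.getVert i) (p.getVert j) + Γ.dist (p.getVert j) v := hΓ.dist_triangle
  omega

end Graph

/-! ### Word metrics -/

section Cayley

variable {G : Type*} [Group G] {A : Set G}

open SimpleGraph

theorem IsFiniteSymmGenSet.adj_iff (hA : IsFiniteSymmGenSet A) {u v : G} :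
    (mulCayley A).Adj u v ↔ u ≠ v ∧ ∃ a ∈ A, v = u * a := by
  rw [mulCayley_adj]
  refine and_congr_right fun _ => ⟨?_, ?_⟩
  · rintro (h | h)
    · exact ⟨_, h, by group⟩
    · refine ⟨u⁻¹ * v, ?_, by group⟩
      rw [← hA.symm, Set.mem_inv]
      simpa using h
  · rintro ⟨a, ha, rfl⟩
    left
    simpa using ha

theorem IsFiniteSymmGenSet.dist_mul_right_le_one (hA : IsFiniteSymmGenSet A) (u : G) {a : G}
    (ha : a ∈ A) : (mulCayley A).dist u (u * a) ≤ 1 := by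
  by_cases h : u = u * a
  · rw [← h]; simp
  · exact (dist_eq_one_iff_adj.2 (hA.adj_iff.2 ⟨h, a, ha, rfl⟩)).le

theorem IsFiniteSymmGenSet.connected (hA : IsFiniteSymmGenSet A) : (mulCayley A).Connected := by
  have key : ∀ g : G, ∀ u, (mulCayley A).Reachable u (u * g) := by
    intro g
    have hg : g ∈ Subgroup.closure A := by rw [hA.closure_eq_top]; trivial
    induction hg using Subgroup.closure_induction with
    | mem a ha =>
      intro u
      by_cases h : u = u * a
      · rw [← h]
      · exact (hA.adj_iff.2 ⟨h, a, ha, rfl⟩).reachable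
    | one => intro u; simp
    | mul x y _ _ hx hy => intro u; rw [← mul_assoc]; exact (hx u).trans (hy _)
    | inv x _ hx => intro u; simpa using (hx (u * x⁻¹)).symm
  refine ⟨fun u v => ?_⟩
  simpa using key (u⁻¹ * v) u

theorem dist_mulCayley_mul_left_le (g u v : G) (h : (mulCayley A).Reachable u v) :
    (mulCayley A).dist (g * u) (g * v) ≤ (mulCayley A).dist u v := by
  obtain ⟨p, hp⟩ := h.exists_walk_length_eq_dist
  rw [← hp]
  let f : mulCayley A →g mulCayley A := ⟨fun x => g * x, fun h => mulCayley_adj_mul_iff_right.2 h⟩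
  exact (dist_le (p.map f)).trans (p.length_map f).le

theorem IsFiniteSymmGenSet.dist_mul_left (hA : IsFiniteSymmGenSet A) (g u v : G) :
    (mulCayley A).dist (g * u) (g * v) = (mulCayley A).dist u v := by
  refine le_antisymm (dist_mulCayley_mul_left_le g u v (hA.connected u v)) ?_
  simpa using dist_mulCayley_mul_left_le g⁻¹ (g * u) (g * v) (hA.connected _ _)

theorem IsFiniteSymmGenSet.dist_eq_dist_one (hA : IsFiniteSymmGenSet A) (u v : G) :
    (mulCayley A).dist u v = (mulCayley A).dist 1 (u⁻¹ * v) := by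
  rw [← hA.dist_mul_left u⁻¹, inv_mul_cancel]

theorem IsFiniteSymmGenSet.finite_ball (hA : IsFiniteSymmGenSet A) (n : ℕ) :
    {x | (mulCayley A).dist 1 x ≤ n}.Finite := by
  induction n with
  | zero =>
    refine (Set.finite_singleton (1 : G)).subset fun x hx => ?_
    have := hA.connected.dist_eq_zero_iff.1 (Nat.le_zero.1 hx)
    exact this.symm
  | succ n ih =>
    refine (ih.union (ih.mul hA.finite)).subset fun x hx => ?_
    obtain ⟨p, hp⟩ := hA.connected.exists_walk_length_eq_dist 1 x
    by_cases h : (mulCayley A).dist 1 x ≤ n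
    · exact Or.inl h
    · have hn : p.length = n + 1 := by
        have : (mulCayley A).dist 1 x ≤ n + 1 := hx
        omega
      have h1 := p.adj_getVert_succ (i := n) (by omega)
      rw [← hn, p.getVert_length] at h1
      obtain ⟨-, a, ha, hx⟩ := hA.adj_iff.1 h1
      refine Or.inr ⟨_, ?_, a, ha, hx.symm⟩
      have := p.dist_getVert_le (Nat.zero_le n)
      rw [p.getVert_zero] at this
      simpa using this

theorem IsFiniteSymmGenSet.exists_forall_dist_le (hA : IsFiniteSymmGenSet A) {B : Set G}
    (hB : IsFiniteSymmGenSet B) :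
    ∃ L : ℕ, ∀ u v, (mulCayley B).dist u v ≤ L * (mulCayley A).dist u v := by
  obtain ⟨L, hL⟩ := (hA.finite.image fun a => (mulCayley B).dist 1 a).bddAbove
  refine ⟨L, hA.connected.dist_le_mul_dist hB.connected id L fun u v h => ?_⟩
  obtain ⟨-, a, ha, rfl⟩ := hA.adj_iff.1 h
  rw [id, id, hB.dist_eq_dist_one]
  simpa using hL ⟨a, ha, rfl⟩

end Cayley

/-! ### The four-point form of hyperbolicity -/

section FourPoint

open SimpleGraph

/-- The four-point inequality, equivalent to Gromov's inequality for the Gromov product. -/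
def FourPoint {X : Type*} (d : X → X → ℕ) (δ : ℝ) (x y z w : X) : Prop :=
  (d x y + d z w : ℝ) ≤ max (d x z + d y w : ℝ) (d x w + d y z) + 2 * δ

theorem gromovProduct_iff_fourPoint {G : Type*} [Group G] (A : Set G) (δ : ℝ) (x y z w : G) :
    min (gromovProduct A x z w) (gromovProduct A y z w) - δ ≤ gromovProduct A x y w ↔
      FourPoint (mulCayley A).dist δ x y z w := by
  unfold gromovProduct wordDist FourPoint
  rw [sub_le_iff_le_add, min_le_iff, ← sub_le_iff_le_add (c := δ), ← sub_le_iff_le_add (c := 2 * δ),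
    le_max_iff, sub_le_iff_le_add, sub_le_iff_le_add, sub_le_iff_le_add]
  constructor <;> rintro (h | h)
  exacts [Or.inl (by linarith), Or.inr (by linarith), Or.inl (by linarith), Or.inr (by linarith)]

end FourPoint

/-! ### Graphs with a gate-like projection -/

section Projection

open SimpleGraph

variable {V : Type*} {Γ : SimpleGraph V} {π : V → V}

/-- Along a walk from x to y the projection must change; at the first change the current vertex is
its own projection, hence equals `π x`. So every walk passes through `π x`. -/
theorem SimpleGraph.Connected.dist_add_dist_of_proj_ne (hΓ : Γ.Connected)
    (hπ : ∀ u v, Γ.Adj u v → π u ≠ π v → π u = u) {x y : V} (hxy : π x ≠ π y) :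
    Γ.dist x y = Γ.dist x (π x) + Γ.dist (π x) y := by
  refine le_antisymm hΓ.dist_triangle ?_
  obtain ⟨p, hp⟩ := hΓ.exists_walk_length_eq_dist x y
  rw [← hp]
  clear hp
  induction p with
  | nil => exact absurd rfl hxy
  | cons h p ih =>
    rename_i a b c
    by_cases hab : π a = π b
    · have h1 := ih (hab ▸ hxy)
      have h2 : Γ.dist a (π a) ≤ Γ.dist a b + Γ.dist b (π a) := hΓ.dist_triangle
      rw [dist_eq_one_iff_adj.2 h, hab] at h2
      rw [Walk.length_cons, hab]
      omega
    · rw [hπ a b h hab, dist_self, zero_add]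
      exact dist_le _

theorem SimpleGraph.Connected.dist_eq_of_proj_ne (hΓ : Γ.Connected)
    (hπ : ∀ u v, Γ.Adj u v → π u ≠ π v → π u = u) (hππ : ∀ u, π (π u) = π u) {x y : V}
    (hxy : π x ≠ π y) :
    Γ.dist x y = Γ.dist x (π x) + Γ.dist (π x) (π y) + Γ.dist y (π y) := by
  rw [hΓ.dist_add_dist_of_proj_ne hπ hxy, dist_comm (u := π x),
    hΓ.dist_add_dist_of_proj_ne hπ (x := y) (y := π x) (by rw [hππ]; exact hxy.symm),
    dist_comm (u := π x)]
  omega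

theorem SimpleGraph.Connected.dist_le_proj (hΓ : Γ.Connected) (x y : V) :
    Γ.dist x y ≤ Γ.dist x (π x) + Γ.dist (π x) (π y) + Γ.dist y (π y) := by
  have h1 : Γ.dist x y ≤ Γ.dist x (π x) + Γ.dist (π x) y := hΓ.dist_triangle
  have h2 : Γ.dist (π x) y ≤ Γ.dist (π x) (π y) + Γ.dist (π y) y := hΓ.dist_triangle
  rw [dist_comm (u := π y)] at h2
  omega

/-- The four-point inequality reduces to the image of a projection, unless three of the points
have the same projection. -/
theorem SimpleGraph.Connected.fourPoint_of_proj (hΓ : Γ.Connected)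
    (hπ : ∀ u v, Γ.Adj u v → π u ≠ π v → π u = u) (hππ : ∀ u, π (π u) = π u) {δ : ℝ} (hδ : 0 ≤ δ)
    {x y z w : V} (h : FourPoint Γ.dist δ (π x) (π y) (π z) (π w))
    (h1 : ¬(π x = π y ∧ π x = π z)) (h2 : ¬(π x = π y ∧ π x = π w))
    (h3 : ¬(π x = π z ∧ π x = π w)) (h4 : ¬(π y = π z ∧ π y = π w)) :
    FourPoint Γ.dist δ x y z w := by
  have eq : ∀ {a b}, π a ≠ π b →
      (Γ.dist a b : ℝ) = Γ.dist a (π a) + Γ.dist (π a) (π b) + Γ.dist b (π b) :=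
    fun hab => by exact_mod_cast hΓ.dist_eq_of_proj_ne hπ hππ hab
  have le : ∀ a b,
      (Γ.dist a b : ℝ) ≤ Γ.dist a (π a) + Γ.dist (π a) (π b) + Γ.dist b (π b) :=
    fun a b => by exact_mod_cast hΓ.dist_le_proj a b
  have hxy := le x y
  have hzw := le z w
  unfold FourPoint at h ⊢
  rw [← sub_le_iff_le_add, le_max_iff, sub_le_iff_le_add, sub_le_iff_le_add] at h ⊢
  -- A coincidence of projections makes one sum on the right split exactly and dominate the left
  -- without using the inequality for the projections.
  by_cases hd : π x = π z ∨ π y = π w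
  · right
    have hxw : π x ≠ π w := by
      rcases hd with hd | hd
      · exact fun e => h3 ⟨hd, e⟩
      · exact fun e => h2 ⟨e.trans hd.symm, e⟩
    have hyz : π y ≠ π z := by
      rcases hd with hd | hd
      · exact fun e => h1 ⟨hd.trans e.symm, hd⟩
      · exact fun e => h4 ⟨e, hd⟩
    rw [eq hxw, eq hyz]
    rcases hd with hd | hd
    · rw [hd, dist_comm (u := π z) (v := π y)] at hxy
      rw [hd]
      linarith
    · rw [← hd] at hzw ⊢
      rw [dist_comm (u := π z) (v := π y)] at hzw
      linarith
  · push Not at hd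
    by_cases hd' : π x = π w ∨ π y = π z
    · left
      rw [eq hd.1, eq hd.2]
      rcases hd' with hd' | hd'
      · rw [hd'] at hxy ⊢
        rw [dist_comm (u := π w) (v := π y)] at hxy
        rw [dist_comm (u := π w) (v := π z)]
        linarith
      · rw [hd'] at hxy ⊢
        linarith
    · push Not at hd'
      rw [eq hd.1, eq hd.2, eq hd'.1, eq hd'.2]
      rcases h with h | h
      · left; linarith
      · right; linarith

end Projection

/-! ### Projections of a free product to its factors -/

namespace Monoid.Coprod

variable {G₁ G₂ : Type*} [Group G₁] [Group G₂]

open scoped Classical in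
/-- The right action of `G₁ ∗ G₂` on pairs `(g, p)` that tracks the nearest point `p` to `g` in
the left factor. -/
noncomputable def projAction :
    Monoid.Coprod G₁ G₂ →* (Function.End (Monoid.Coprod G₁ G₂ × G₁))ᵐᵒᵖ :=
  -- The universal property replaces normal forms: starting from `(1, 1)`, the second component
  -- collects a letter of `G₁` exactly when the running product lies in `G₁`.
  lift
    { toFun := fun a => MulOpposite.op fun t =>
        (t.1 * inl a, if t.1 ∈ (inl : G₁ →* Monoid.Coprod G₁ G₂).range then t.2 * a else t.2)
      map_one' := by
        refine MulOpposite.unop_injective (funext fun t => ?_)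
        change (t.1 * inl 1, ite _ (t.2 * 1) t.2) = t
        simp
      map_mul' := fun a b => by
        refine MulOpposite.unop_injective (funext fun t => ?_)
        have : t.1 * inl a ∈ (inl : G₁ →* Monoid.Coprod G₁ G₂).range ↔
            t.1 ∈ (inl : G₁ →* Monoid.Coprod G₁ G₂).range :=
          Subgroup.mul_mem_cancel_right _ ⟨a, rfl⟩
        change (t.1 * inl (a * b), ite _ (t.2 * (a * b)) t.2) =
          (t.1 * inl a * inl b,
            if t.1 * inl a ∈ (inl : G₁ →* Monoid.Coprod G₁ G₂).range then
              (ite _ (t.2 * a) t.2) * b else ite _ (t.2 * a) t.2)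
        by_cases h : t.1 ∈ (inl : G₁ →* Monoid.Coprod G₁ G₂).range
        · simp only [this, h, if_true, map_mul, mul_assoc]
        · simp only [this, h, if_false, map_mul, mul_assoc] }
    { toFun := fun b => MulOpposite.op fun t => (t.1 * inr b, t.2)
      map_one' := by
        refine MulOpposite.unop_injective (funext fun t => ?_)
        change (t.1 * inr 1, t.2) = t
        simp
      map_mul' := fun a b => by
        refine MulOpposite.unop_injective (funext fun t => ?_)
        change (t.1 * inr (a * b), t.2) = (t.1 * inr a * inr b, t.2)
        rw [map_mul, mul_assoc] }

theorem projAction_mul_apply (g h : Monoid.Coprod G₁ G₂) (t : Monoid.Coprod G₁ G₂ × G₁) :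
    (projAction (g * h)).unop t = (projAction h).unop ((projAction g).unop t) := by
  rw [map_mul]
  rfl

/-- The nearest-point projection of a free product to its left factor. -/
noncomputable def projLeft (g : Monoid.Coprod G₁ G₂) : G₁ :=
  ((projAction g).unop (1, 1)).2

theorem projAction_fst (g : Monoid.Coprod G₁ G₂) (t : Monoid.Coprod G₁ G₂ × G₁) :
    ((projAction g).unop t).1 = t.1 * g := by
  induction g using Monoid.Coprod.induction_on generalizing t with
  | inl a => rfl
  | inr b => rfl
  | mul x y hx hy =>
    rw [projAction_mul_apply, hy, hx, mul_assoc]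

theorem projAction_mul (g h : Monoid.Coprod G₁ G₂) :
    (projAction (g * h)).unop (1, 1) = (projAction h).unop (g, projLeft g) := by
  have h : (projAction g).unop (1, 1) = (g, projLeft g) :=
    Prod.ext ((projAction_fst g (1, 1)).trans (one_mul g)) rfl
  rw [projAction_mul_apply, h]

theorem projLeft_mul_inr (g : Monoid.Coprod G₁ G₂) (b : G₂) :
    projLeft (g * inr b) = projLeft g := by
  rw [projLeft, projAction_mul]
  rfl

theorem projLeft_mul_inl_of_notMem {g : Monoid.Coprod G₁ G₂}
    (hg : g ∉ (inl : G₁ →* Monoid.Coprod G₁ G₂).range) (a : G₁) :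
    projLeft (g * inl a) = projLeft g := by
  rw [projLeft, projAction_mul]
  exact if_neg hg

theorem projLeft_one : projLeft (1 : Monoid.Coprod G₁ G₂) = 1 := by
  rw [projLeft, map_one]
  rfl

theorem projLeft_inl (a : G₁) : projLeft (inl a : Monoid.Coprod G₁ G₂) = a := by
  rw [← one_mul (inl a : Monoid.Coprod G₁ G₂), projLeft, projAction_mul, projLeft_one]
  exact (if_pos (one_mem (inl : G₁ →* Monoid.Coprod G₁ G₂).range)).trans (one_mul a)

theorem mem_range_inl_of_projLeft_mul_ne {g : Monoid.Coprod G₁ G₂} {a : G₁}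
    (h : projLeft (g * inl a) ≠ projLeft g) : inl (projLeft g) = g := by
  by_cases hg : g ∈ (inl : G₁ →* Monoid.Coprod G₁ G₂).range
  · obtain ⟨k, rfl⟩ := hg
    rw [projLeft_inl]
  · exact absurd (projLeft_mul_inl_of_notMem hg a) h

/-- The nearest-point projection of a free product to its right factor. -/
noncomputable def projRight (g : Monoid.Coprod G₁ G₂) : G₂ :=
  projLeft (swap G₁ G₂ g)

theorem projRight_inr (b : G₂) : projRight (inr b : Monoid.Coprod G₁ G₂) = b := by
  rw [projRight, swap_inr, projLeft_inl]

theorem projRight_mul_inl (g : Monoid.Coprod G₁ G₂) (a : G₁) :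
    projRight (g * inl a) = projRight g := by
  rw [projRight, map_mul, swap_inl, projLeft_mul_inr, projRight]

theorem projRight_one : projRight (1 : Monoid.Coprod G₁ G₂) = 1 := by
  rw [← map_one inr, projRight_inr]

theorem mem_range_inr_of_projRight_mul_ne {g : Monoid.Coprod G₁ G₂} {b : G₂}
    (h : projRight (g * inr b) ≠ projRight g) : inr (projRight g) = g := by
  rw [projRight, projRight, map_mul, swap_inr] at h
  have := congrArg (swap G₂ G₁) (mem_range_inl_of_projLeft_mul_ne h)
  rwa [swap_inl, swap_swap] at this

/-- The first syllable of a nontrivial element is seen by one of the projections. The induction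
multiplies a prefix `h` on the right by letters: either the relevant projection is unchanged, or `h`
lies in that factor. -/
theorem eq_one_of_proj_eq_one {g : Monoid.Coprod G₁ G₂} (h₁ : projLeft g = 1)
    (h₂ : projRight g = 1) : g = 1 := by
  have key : ∀ g h : Monoid.Coprod G₁ G₂, (projLeft h = 1 → projRight h = 1 → h = 1) →
      projLeft (h * g) = 1 → projRight (h * g) = 1 → h * g = 1 := by
    intro g
    induction g using Monoid.Coprod.induction_on with
    | inl a =>
      intro h ih h₁ h₂
      by_cases hh : projLeft (h * inl a) = projLeft h
      · rw [projRight_mul_inl] at h₂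
        rw [hh] at h₁
        rw [ih h₁ h₂, one_mul, projLeft_inl, projLeft_one] at hh
        rw [ih h₁ h₂, hh, map_one, one_mul]
      · have := mem_range_inl_of_projLeft_mul_ne hh
        rw [← this, ← map_mul, projLeft_inl] at h₁
        rw [← this, ← map_mul, h₁, map_one]
    | inr b =>
      intro h ih h₁ h₂
      by_cases hh : projRight (h * inr b) = projRight h
      · rw [projLeft_mul_inr] at h₁
        rw [hh] at h₂
        rw [ih h₁ h₂, one_mul, projRight_inr, projRight_one] at hh
        rw [ih h₁ h₂, hh, map_one, one_mul]
      · have := mem_range_inr_of_projRight_mul_ne hh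
        rw [← this, ← map_mul, projRight_inr] at h₂
        rw [← this, ← map_mul, h₂, map_one]
    | mul x y hx hy =>
      intro h ih
      rw [← mul_assoc]
      exact hy _ (hx _ ih)
  simpa [h₁, h₂] using key g 1 (fun _ _ => rfl)

end Monoid.Coprod

/-! ### Hyperbolicity of the free product -/

section Hyperbolic

open Monoid.Coprod SimpleGraph

variable {G₁ G₂ : Type*} [Group G₁] [Group G₂] {A₁ : Set G₁} {A₂ : Set G₂}

/-- The union of generating sets of the factors, as a subset of the free product. -/
def coprodGenSet (A₁ : Set G₁) (A₂ : Set G₂) : Set (Monoid.Coprod G₁ G₂) :=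
  inl '' A₁ ∪ inr '' A₂

theorem IsFiniteSymmGenSet.coprod (h₁ : IsFiniteSymmGenSet A₁) (h₂ : IsFiniteSymmGenSet A₂) :
    IsFiniteSymmGenSet (coprodGenSet A₁ A₂) where
  finite := (h₁.finite.image _).union (h₂.finite.image _)
  symm := by
    rw [coprodGenSet, Set.union_inv, ← Set.image_inv, ← Set.image_inv, h₁.symm, h₂.symm]
  closure_eq_top := by
    rw [coprodGenSet, Subgroup.closure_union, ← MonoidHom.map_closure, ← MonoidHom.map_closure,
      h₁.closure_eq_top, h₂.closure_eq_top, ← MonoidHom.range_eq_map, ← MonoidHom.range_eq_map,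
      range_inl_sup_range_inr]

/-- Both `inl` and its retraction `fst` are 1-Lipschitz. -/
theorem dist_coprodGenSet_inl (h₁ : IsFiniteSymmGenSet A₁) (h₂ : IsFiniteSymmGenSet A₂) (u v : G₁) :
    (mulCayley (coprodGenSet A₁ A₂)).dist (inl u) (inl v) = (mulCayley A₁).dist u v := by
  have h := h₁.coprod h₂
  refine le_antisymm ?_ ?_
  · rw [← one_mul ((mulCayley A₁).dist u v)]
    refine h₁.connected.dist_le_mul_dist h.connected _ 1 (fun u v huv => ?_) u v
    obtain ⟨-, a, ha, rfl⟩ := h₁.adj_iff.1 huv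
    rw [map_mul]
    exact h.dist_mul_right_le_one _ (Or.inl ⟨a, ha, rfl⟩)
  · rw [← one_mul ((mulCayley (coprodGenSet A₁ A₂)).dist (inl u) (inl v))]
    refine h.connected.dist_le_mul_dist h₁.connected (fst : Monoid.Coprod G₁ G₂ →* G₁) 1
      (fun u v huv => ?_) (inl u) (inl v)
    obtain ⟨-, a, (⟨a, ha, rfl⟩ | ⟨a, ha, rfl⟩), rfl⟩ := h.adj_iff.1 huv
    · rw [map_mul, fst_apply_inl]
      exact h₁.dist_mul_right_le_one _ ha
    · simp

theorem dist_coprodGenSet_inr (h₁ : IsFiniteSymmGenSet A₁) (h₂ : IsFiniteSymmGenSet A₂) (u v : G₂) :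
    (mulCayley (coprodGenSet A₁ A₂)).dist (inr u) (inr v) = (mulCayley A₂).dist u v := by
  have h := h₁.coprod h₂
  refine le_antisymm ?_ ?_
  · rw [← one_mul ((mulCayley A₂).dist u v)]
    refine h₂.connected.dist_le_mul_dist h.connected _ 1 (fun u v huv => ?_) u v
    obtain ⟨-, a, ha, rfl⟩ := h₂.adj_iff.1 huv
    rw [map_mul]
    exact h.dist_mul_right_le_one _ (Or.inr ⟨a, ha, rfl⟩)
  · rw [← one_mul ((mulCayley (coprodGenSet A₁ A₂)).dist (inr u) (inr v))]
    refine h.connected.dist_le_mul_dist h₂.connected (snd : Monoid.Coprod G₁ G₂ →* G₂) 1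
      (fun u v huv => ?_) (inr u) (inr v)
    obtain ⟨-, a, (⟨a, ha, rfl⟩ | ⟨a, ha, rfl⟩), rfl⟩ := h.adj_iff.1 huv
    · simp
    · rw [map_mul, snd_apply_inr]
      exact h₂.dist_mul_right_le_one _ ha

/-- If some point has a projection other than the identity, the four-point inequality for
`x, y, z, 1` follows from the one on the image of the projection and from the inequality for
translates closer to the identity. -/
theorem fourPoint_one_of_proj {G : Type*} [Group G] {B : Set G} (hB : IsFiniteSymmGenSet B)
    {π : G → G} (hπ : ∀ u v, (mulCayley B).Adj u v → π u ≠ π v → π u = u)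
    (hππ : ∀ u, π (π u) = π u) (hπ1 : π 1 = 1) {δ : ℝ} (hδ : 0 ≤ δ)
    (hP : ∀ x y z w, FourPoint (mulCayley B).dist δ (π x) (π y) (π z) (π w)) {x y z : G}
    (ih : ∀ x' y' z', (mulCayley B).dist x' 1 + (mulCayley B).dist y' 1 + (mulCayley B).dist z' 1 <
      (mulCayley B).dist x 1 + (mulCayley B).dist y 1 + (mulCayley B).dist z 1 →
        FourPoint (mulCayley B).dist δ x' y' z' 1)
    (hne : ¬(π x = 1 ∧ π y = 1 ∧ π z = 1)) : FourPoint (mulCayley B).dist δ x y z 1 := by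
  have hΓ := hB.connected
  have tri : ∀ a b c : G, ((mulCayley B).dist a c : ℝ) ≤
      (mulCayley B).dist a b + (mulCayley B).dist b c :=
    fun a b c => by exact_mod_cast hΓ.dist_triangle
  have split : ∀ {a b : G}, π a ≠ π b → π b = 1 →
      ((mulCayley B).dist a b : ℝ) = (mulCayley B).dist a 1 + (mulCayley B).dist 1 b := by
    intro a b h h'
    have := hΓ.dist_add_dist_of_proj_ne hπ h.symm
    rw [h'] at this
    rw [dist_comm, this, Nat.cast_add, dist_comm (u := b), dist_comm (u := a), add_comm]
  -- Translating a common projection to 1 shortens all three distances to 1 by the same amount. Each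
  -- of the three sums contains exactly one such distance, so the inequality is unaffected.
  by_cases h1 : π x = π y ∧ π x = π z
  · obtain ⟨hxy, hxz⟩ := h1
    have hx : π x ≠ 1 := fun h => hne ⟨h, hxy ▸ h, hxz ▸ h⟩
    have shift : ∀ g, π g = π x →
        (mulCayley B).dist ((π x)⁻¹ * g) 1 < (mulCayley B).dist g 1 := by
      intro g hg
      have h := hΓ.dist_add_dist_of_proj_ne hπ (x := g) (y := 1) (by rwa [hg, hπ1])
      have hpos := hΓ.pos_dist_of_ne hx
      rw [hg] at h
      rw [← hB.dist_mul_left (π x), mul_inv_cancel_left, mul_one]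
      omega
    have key := ih ((π x)⁻¹ * x) ((π x)⁻¹ * y) ((π x)⁻¹ * z) (by
      have := shift x rfl
      have := shift y hxy.symm
      have := shift z hxz.symm
      omega)
    have back : ∀ g, π g = π x → ((mulCayley B).dist g 1 : ℝ) =
        (mulCayley B).dist ((π x)⁻¹ * g) 1 + (mulCayley B).dist (π x) 1 := by
      intro g hg
      have h := hΓ.dist_add_dist_of_proj_ne hπ (x := g) (y := 1) (by rwa [hg, hπ1])
      rw [← hB.dist_mul_left (π x) ((π x)⁻¹ * g) 1, mul_inv_cancel_left, mul_one]
      rw [hg] at h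
      exact_mod_cast h
    unfold FourPoint at key ⊢
    simp only [hB.dist_mul_left] at key
    rw [back x rfl, back y hxy.symm, back z hxz.symm]
    rw [← sub_le_iff_le_add, le_max_iff, sub_le_iff_le_add, sub_le_iff_le_add] at key ⊢
    rcases key with h | h
    · left; linarith
    · right; linarith
  -- If exactly one point does not project to 1, then 1 lies on geodesics from it to the other two.
  -- In this case and the next two, the triangle inequality or an equality suffices.
  by_cases h2 : π x = π y ∧ π x = π 1
  · rw [hπ1] at h2
    have hz : π z ≠ 1 := fun h => hne ⟨h2.2, h2.1 ▸ h2.2, h⟩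
    have hx := split (a := z) (b := x) (by rwa [h2.2]) h2.2
    have := tri x 1 y
    unfold FourPoint
    rw [← sub_le_iff_le_add, le_max_iff, sub_le_iff_le_add, sub_le_iff_le_add]
    left
    rw [dist_comm (u := x) (v := z), hx, dist_comm (u := y) (v := 1), dist_comm (u := 1) (v := x)]
    linarith
  by_cases h3 : π x = π z ∧ π x = π 1
  · rw [hπ1] at h3
    have hy : π y ≠ 1 := fun h => hne ⟨h3.2, h, h3.1 ▸ h3.2⟩
    have hx := split (a := y) (b := x) (by rwa [h3.2]) h3.2
    have hz := split (a := y) (b := z) (by rwa [← h3.1, h3.2]) (by rw [← h3.1, h3.2])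
    unfold FourPoint
    rw [← sub_le_iff_le_add, le_max_iff, sub_le_iff_le_add, sub_le_iff_le_add]
    right
    rw [dist_comm (u := x) (v := y), hx, hz, dist_comm (u := 1) (v := x),
      dist_comm (u := z) (v := 1)]
    linarith
  by_cases h4 : π y = π z ∧ π y = π 1
  · rw [hπ1] at h4
    have hx : π x ≠ 1 := fun h => hne ⟨h, h4.2, h4.1 ▸ h4.2⟩
    have hy := split (a := x) (b := y) (by rwa [h4.2]) h4.2
    have hz := split (a := x) (b := z) (by rwa [← h4.1, h4.2]) (by rw [← h4.1, h4.2])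
    unfold FourPoint
    rw [← sub_le_iff_le_add, le_max_iff, sub_le_iff_le_add, sub_le_iff_le_add]
    left
    rw [hy, hz, dist_comm (u := 1) (v := y), dist_comm (u := z) (v := 1)]
    linarith
  exact hΓ.fourPoint_of_proj hπ hππ hδ (hP _ _ _ _) h1 h2 h3 h4

/-- Translate w to 1 and induct on the total distance of the other points to 1. Unless all are 1,
one of the factors sees a nontrivial projection. -/
theorem fourPoint_coprodGenSet (h₁ : IsFiniteSymmGenSet A₁) (h₂ : IsFiniteSymmGenSet A₂) {δ : ℝ}
    (hδ : 0 ≤ δ) (hF₁ : ∀ x y z w, FourPoint (mulCayley A₁).dist δ x y z w)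
    (hF₂ : ∀ x y z w, FourPoint (mulCayley A₂).dist δ x y z w) (x y z w : Monoid.Coprod G₁ G₂) :
    FourPoint (mulCayley (coprodGenSet A₁ A₂)).dist δ x y z w := by
  have hB := h₁.coprod h₂
  suffices h : ∀ n : ℕ, ∀ x y z : Monoid.Coprod G₁ G₂,
      (mulCayley (coprodGenSet A₁ A₂)).dist x 1 + (mulCayley (coprodGenSet A₁ A₂)).dist y 1 +
        (mulCayley (coprodGenSet A₁ A₂)).dist z 1 = n →
      FourPoint (mulCayley (coprodGenSet A₁ A₂)).dist δ x y z 1 by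
    have := h _ (w⁻¹ * x) (w⁻¹ * y) (w⁻¹ * z) rfl
    unfold FourPoint at this ⊢
    rw [← inv_mul_cancel w] at this
    simpa only [hB.dist_mul_left] using this
  intro n
  induction n using Nat.strong_induction_on with
  | _ n ih =>
    rintro x y z rfl
    by_cases hl : projLeft x = 1 ∧ projLeft y = 1 ∧ projLeft z = 1
    · by_cases hr : projRight x = 1 ∧ projRight y = 1 ∧ projRight z = 1
      · rw [eq_one_of_proj_eq_one hl.1 hr.1, eq_one_of_proj_eq_one hl.2.1 hr.2.1,
          eq_one_of_proj_eq_one hl.2.2 hr.2.2]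
        simp [FourPoint, hδ]
      · refine fourPoint_one_of_proj hB (π := fun g => inr (projRight g)) (fun u v huv hne => ?_)
          (fun u => by rw [projRight_inr]) (by rw [projRight_one, map_one]) hδ (fun x y z w => ?_)
          (fun x' y' z' h => ih _ h x' y' z' rfl) ?_
        · obtain ⟨-, a, (⟨a, ha, rfl⟩ | ⟨a, ha, rfl⟩), rfl⟩ := hB.adj_iff.1 huv
          · exact absurd (congrArg inr (projRight_mul_inl _ _).symm) hne
          · exact mem_range_inr_of_projRight_mul_ne fun h => hne (congrArg inr h.symm)
        · simpa only [FourPoint, dist_coprodGenSet_inr h₁ h₂] using hF₂ _ _ _ _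
        · simpa only [map_eq_one_iff _ inr_injective] using hr
    · refine fourPoint_one_of_proj hB (π := fun g => inl (projLeft g)) (fun u v huv hne => ?_)
        (fun u => by rw [projLeft_inl]) (by rw [projLeft_one, map_one]) hδ (fun x y z w => ?_)
        (fun x' y' z' h => ih _ h x' y' z' rfl) ?_
      · obtain ⟨-, a, (⟨a, ha, rfl⟩ | ⟨a, ha, rfl⟩), rfl⟩ := hB.adj_iff.1 huv
        · exact mem_range_inl_of_projLeft_mul_ne fun h => hne (congrArg inl h.symm)
        · exact absurd (congrArg inl (projLeft_mul_inr _ _).symm) hne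
      · simpa only [FourPoint, dist_coprodGenSet_inl h₁ h₂] using hF₁ _ _ _ _
      · simpa only [map_eq_one_iff _ inl_injective] using hl

end Hyperbolic

/-! ### Stability of quasigeodesics -/

section Morse

variable {X : Type*} {d : X → X → ℕ} {δ : ℝ}

/-- Gromov's inequality at base point p, with doubled products to avoid halves. -/
theorem FourPoint.le_trans (hsymm : ∀ x y, d x y = d y x) {x y z p : X} {M : ℝ}
    (h : FourPoint d δ x z y p) (hxy : 2 * M ≤ d x p + d y p - d x y)
    (hyz : 2 * M ≤ d y p + d z p - d y z) : 2 * (M - δ) ≤ d x p + d z p - d x z := by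
  unfold FourPoint at h
  rw [hsymm z y, ← sub_le_iff_le_add, le_max_iff, sub_le_iff_le_add, sub_le_iff_le_add] at h
  rcases h with h | h <;> linarith

/-- If `x 0, …, x N` is a chain with `N ≤ 2 ^ k` all of whose steps have Gromov product at least
`M` with respect to `p`, then its endpoints have Gromov product at least `M - k * δ`. -/
theorem FourPoint.le_of_chain (hsymm : ∀ x y, d x y = d y x) (hδ : 0 ≤ δ)
    (hF : ∀ x y z w, FourPoint d δ x y z w) (p : X) {M : ℝ} (k : ℕ) :
    ∀ (x : ℕ → X) (N : ℕ), 0 < N → N ≤ 2 ^ k →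
      (∀ i < N, 2 * M ≤ d (x i) p + d (x (i + 1)) p - d (x i) (x (i + 1))) →
      2 * (M - k * δ) ≤ d (x 0) p + d (x N) p - d (x 0) (x N) := by
  induction k with
  | zero =>
    intro x N hN hN' h
    obtain rfl : N = 1 := by simp at hN'; omega
    simpa using h 0 one_pos
  | succ k ih =>
    intro x N hN hN' h
    by_cases hle : N ≤ 2 ^ k
    · have := ih x N hN hle h
      push_cast
      linarith
    -- Bisection costs one δ per halving, so the loss is logarithmic in the length of the chain.
    · push Not at hle
      have h1 := ih x (2 ^ k) (by positivity) le_rfl fun i hi => h i (by omega)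
      have h2 := ih (fun i => x (2 ^ k + i)) (N - 2 ^ k) (by omega) (by rw [pow_succ] at hN'; omega)
        fun i hi => h (2 ^ k + i) (by omega)
      simp only [add_zero, Nat.add_sub_cancel' hle.le] at h2
      have := FourPoint.le_trans hsymm (hF (x 0) (x N) (x (2 ^ k)) p) h1 h2
      push_cast
      linarith

theorem Nat.exists_forall_mul_add_le_two_pow (a b : ℕ) : ∃ K, ∀ k ≥ K, a * k + b ≤ 2 ^ k := by
  -- With `c = 2 * a + b`, `2 ^ (2 * c) ≥ (c + 1) ^ 2 ≥ 2 * a * c + b`; `ha` pays for each later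
  -- increment.
  refine ⟨2 * (2 * a + b), fun k hk => ?_⟩
  have ha : a ≤ 2 ^ (2 * (2 * a + b)) :=
    (Nat.lt_two_pow_self (n := a)).le.trans (Nat.pow_le_pow_right two_pos (by omega))
  induction k, hk using Nat.le_induction with
  | base =>
    have h : 2 * a + b + 1 ≤ 2 ^ (2 * a + b) := Nat.lt_two_pow_self
    rw [two_mul (2 * a + b), pow_add]
    have := Nat.mul_le_mul h h
    nlinarith
  | succ k hk ih =>
    have := Nat.pow_le_pow_right two_pos hk
    rw [pow_succ]
    nlinarith

/-- The key estimate for the stability of quasigeodesics: if `D` is the largest distance of a point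
of the geodesic `p` to the quasigeodesic `c`, then `D` is logarithmic in itself. -/
theorem FourPoint.le_of_isMax_dist (hself : ∀ x, d x x = 0) (hsymm : ∀ x y, d x y = d y x)
    (htri : ∀ x y z, d x z ≤ d x y + d y z) (hδ : 0 ≤ δ) (hF : ∀ x y z w, FourPoint d δ x y z w)
    {C R D n m k t : ℕ} {p c : ℕ → X}
    (hp : ∀ i j, i ≤ j → j ≤ n → d (p i) (p j) = j - i)
    (hc : ∀ i < m, d (c i) (c (i + 1)) ≤ R)
    (hqc : ∀ i j, i ≤ j → j ≤ m → j - i ≤ C * d (c i) (c j))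
    (h0 : d (p 0) (c 0) ≤ R) (hn : d (p n) (c m) ≤ R) (ht : t ≤ n)
    (hDt : ∀ j ≤ m, D ≤ d (p t) (c j)) (hD : ∀ s ≤ n, ∃ j ≤ m, d (p s) (c j) ≤ D)
    (hk : C * (6 * D + 2 * R) ≤ 2 ^ k) : (D : ℝ) ≤ R + (k + 2) * δ := by
  have hDt' : ∀ j ≤ m, (D : ℝ) ≤ d (c j) (p t) := fun j hj => by
    rw [hsymm]; exact_mod_cast hDt j hj
  -- Go back `2 * D` along the geodesic, or to its start, and jump to the quasigeodesic. Far from `p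
  -- t`, even a jump of length D keeps the Gromov product at least `D - R`.
  obtain ⟨a, i, ha, hta, hi, hai, hgi⟩ : ∃ a i, a ≤ t ∧ t - a ≤ 2 * D ∧ i ≤ m ∧
      d (p a) (c i) ≤ D + R ∧
      2 * ((D : ℝ) - R) ≤ d (p a) (p t) + d (c i) (p t) - d (p a) (c i) := by
    by_cases h : 2 * D ≤ t
    · obtain ⟨i, hi, hdi⟩ := hD (t - 2 * D) (by omega)
      refine ⟨t - 2 * D, i, by omega, by omega, hi, by omega, ?_⟩
      have h1 : d (p (t - 2 * D)) (p t) = 2 * D := by rw [hp _ _ (by omega) ht]; omega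
      have h2 : (d (p (t - 2 * D)) (c i) : ℝ) ≤ D := by exact_mod_cast hdi
      have h3 := hDt' i hi
      have h4 : (0 : ℝ) ≤ R := by positivity
      rw [h1]
      push_cast
      linarith
    · refine ⟨0, 0, by omega, by omega, by omega, by omega, ?_⟩
      have h1 : (d (c 0) (p t) : ℝ) ≤ d (c 0) (p 0) + d (p 0) (p t) := by exact_mod_cast htri _ _ _
      have h2 : (d (p 0) (c 0) : ℝ) ≤ R := by exact_mod_cast h0
      have h3 := hDt' 0 (by omega)
      rw [hsymm (c 0) (p 0)] at h1
      linarith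
  obtain ⟨b, j, hb, hbn, htb, hj, hbj, hgj⟩ : ∃ b j, t ≤ b ∧ b ≤ n ∧ b - t ≤ 2 * D ∧ j ≤ m ∧
      d (p b) (c j) ≤ D + R ∧
      2 * ((D : ℝ) - R) ≤ d (c j) (p t) + d (p b) (p t) - d (c j) (p b) := by
    by_cases h : t + 2 * D ≤ n
    · obtain ⟨j, hj, hdj⟩ := hD (t + 2 * D) h
      refine ⟨t + 2 * D, j, by omega, h, by omega, hj, by omega, ?_⟩
      have h1 : d (p (t + 2 * D)) (p t) = 2 * D := by rw [hsymm, hp _ _ (by omega) h]; omega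
      have h2 : (d (p (t + 2 * D)) (c j) : ℝ) ≤ D := by exact_mod_cast hdj
      have h3 := hDt' j hj
      have h4 : (0 : ℝ) ≤ R := by positivity
      rw [h1, hsymm (c j) (p (t + 2 * D))]
      push_cast
      linarith
    · refine ⟨n, m, ht, le_rfl, by omega, le_rfl, by omega, ?_⟩
      have h1 : (d (c m) (p t) : ℝ) ≤ d (c m) (p n) + d (p n) (p t) := by exact_mod_cast htri _ _ _
      have h2 : (d (p n) (c m) : ℝ) ≤ R := by exact_mod_cast hn
      have h3 := hDt' m le_rfl
      rw [hsymm (c m) (p n)] at h1 ⊢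
      linarith
  -- Two jumps of at most `D + R` and a geodesic piece of at most `4 * D`.
  have hij : d (c i) (c j) ≤ 6 * D + 2 * R := by
    have h1 := htri (c i) (p a) (c j)
    have h2 := htri (p a) (p b) (c j)
    rw [hsymm (c i) (p a)] at h1
    rw [hp a b (by omega) hbn] at h2
    omega
  have step : ∀ l < m, 2 * ((D : ℝ) - R) ≤
      d (c l) (p t) + d (c (l + 1)) (p t) - d (c l) (c (l + 1)) := by
    intro l hl
    have h1 : (d (c l) (c (l + 1)) : ℝ) ≤ R := by exact_mod_cast hc l hl
    have h2 := hDt' l hl.le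
    have h3 := hDt' (l + 1) hl
    have h4 : (0 : ℝ) ≤ R := by positivity
    linarith
  have chain : ∀ i j, i ≤ j → j ≤ m → d (c i) (c j) ≤ 6 * D + 2 * R →
      2 * ((D : ℝ) - R - k * δ) ≤ d (c i) (p t) + d (c j) (p t) - d (c i) (c j) := by
    intro i j hij hj hd
    rcases hij.eq_or_lt with rfl | hlt
    · rw [hself]
      have h2 := hDt' i hj
      have h4 : (0 : ℝ) ≤ R := by positivity
      have h5 : (0 : ℝ) ≤ k * δ := by positivity
      push_cast
      linarith
    · have := FourPoint.le_of_chain hsymm hδ hF (p t) (M := D - R) k (fun l => c (i + l)) (j - i)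
        (by omega) ((hqc i j hij hj).trans ((Nat.mul_le_mul_left C hd).trans hk))
        fun l hl => step (i + l) (by omega)
      simpa only [add_zero, Nat.add_sub_cancel' hij] using this
  have hgij : 2 * ((D : ℝ) - R - k * δ) ≤ d (c i) (p t) + d (c j) (p t) - d (c i) (c j) := by
    rcases le_total i j with h | h
    · exact chain i j h hj hij
    · have := chain j i h hi (by rwa [hsymm])
      rw [hsymm (c j) (c i)] at this
      linarith
  have hkδ : (0 : ℝ) ≤ k * δ := by positivity
  -- Adding the two jumps to the chain costs 2δ more, whereas the product of `p a` and `p b` at `p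
  -- t` is 0, as `p t` lies between them.
  have g1 := FourPoint.le_trans hsymm (hF (p a) (c j) (c i) (p t)) (M := D - R - k * δ)
    (by linarith) hgij
  have g2 := FourPoint.le_trans hsymm (hF (p a) (p b) (c j) (p t)) g1 (by linarith)
  have e : (d (p a) (p t) : ℝ) + d (p b) (p t) - d (p a) (p b) = 0 := by
    rw [hsymm (p b) (p t), sub_eq_zero]
    have := hp a t ha ht
    have := hp t b hb hbn
    have := hp a b (by omega) hbn
    exact_mod_cast (by omega : d (p a) (p t) + d (p t) (p b) = d (p a) (p b))
  rw [e] at g2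
  linarith

/-- In a hyperbolic space, geodesics stay close to quasigeodesics with the same endpoints, up to a
bounded error. -/
theorem FourPoint.exists_dist_le_of_quasigeodesic (hself : ∀ x, d x x = 0)
    (hsymm : ∀ x y, d x y = d y x) (htri : ∀ x y z, d x z ≤ d x y + d y z) (hδ : 0 ≤ δ)
    (hF : ∀ x y z w, FourPoint d δ x y z w) (C R : ℕ) :
    ∃ D : ℕ, ∀ (n m : ℕ) (p c : ℕ → X),
      (∀ i j, i ≤ j → j ≤ n → d (p i) (p j) = j - i) →
      (∀ i < m, d (c i) (c (i + 1)) ≤ R) →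
      (∀ i j, i ≤ j → j ≤ m → j - i ≤ C * d (c i) (c j)) →
      d (p 0) (c 0) ≤ R → d (p n) (c m) ≤ R → ∀ s ≤ n, ∃ j ≤ m, d (p s) (c j) ≤ D := by
  obtain ⟨e, he⟩ := exists_nat_ge δ
  -- Positive even if δ = 0, so that the layers of width `E` used below exhaust ℕ.
  set E := e + 1
  have hE : δ ≤ E := he.trans (by exact_mod_cast Nat.le_succ e)
  obtain ⟨K, hK⟩ := Nat.exists_forall_mul_add_le_two_pow (C * (6 * E)) (C * (6 * (R + 3 * E) + 2 * R))
  refine ⟨R + (K + 2) * E, fun n m p c hp hc hqc h0 hn => ?_⟩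
  have hmin : ∀ s, ∃ j ≤ m, ∀ i ≤ m, d (p s) (c j) ≤ d (p s) (c i) := by
    intro s
    obtain ⟨j, hj, h⟩ := Finset.exists_min_image (Finset.range (m + 1)) (fun j => d (p s) (c j))
      ⟨0, by simp⟩
    exact ⟨j, by simpa [Nat.lt_succ_iff] using hj, fun i hi => h i (by simpa [Nat.lt_succ_iff] using hi)⟩
  choose j hj hjmin using hmin
  obtain ⟨t, ht, htmax⟩ := Finset.exists_max_image (Finset.range (n + 1))
    (fun s => d (p s) (c (j s))) ⟨0, by simp⟩
  simp only [Finset.mem_range, Nat.lt_succ_iff] at ht htmax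
  set D := d (p t) (c (j t)) with hDdef
  suffices hD : D ≤ R + (K + 2) * E from fun s hs => ⟨j s, hj s, (htmax s hs).trans hD⟩
  by_contra! hD
  -- The upper bound makes `2 ^ k` exceed the chain length, by the choice of `K`; the key estimate
  -- then contradicts the lower bound.
  obtain ⟨k, hkK, hk1, hk2⟩ : ∃ k ≥ K, R + (k + 2) * E < D ∧ D ≤ R + (k + 3) * E := by
    have hex : ∃ k, D ≤ R + (k + 3) * E := ⟨D, by
      have : D * 1 ≤ D * E := Nat.mul_le_mul_left _ (by omega)
      nlinarith⟩
    classical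
    refine ⟨max K (Nat.find hex), le_max_left _ _, ?_, (Nat.find_spec hex).trans (by gcongr; omega)⟩
    rcases max_choice K (Nat.find hex) with h | h
    · rwa [h]
    · rw [h]
      rcases Nat.eq_zero_or_pos (Nat.find hex) with h' | h'
      · have : K = 0 := by omega
        rwa [h', ← this]
      · have := Nat.find_min hex (m := Nat.find hex - 1) (by omega)
        rw [show Nat.find hex - 1 + 3 = Nat.find hex + 2 by omega] at this
        omega
  have key := FourPoint.le_of_isMax_dist hself hsymm htri hδ hF hp hc hqc h0 hn ht
    (fun i hi => hjmin t i hi) (fun s hs => ⟨j s, hj s, htmax s hs⟩) (k := k) (by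
      refine (hK k hkK).trans' ?_
      have := Nat.mul_le_mul_left C (show 6 * D + 2 * R ≤ 6 * (R + (k + 3) * E) + 2 * R by omega)
      refine this.trans (le_of_eq ?_)
      ring)
  have h1 : (R + (k + 2) * E : ℝ) < D := by exact_mod_cast hk1
  have h2 : ((k : ℝ) + 2) * δ ≤ (k + 2) * E := by gcongr
  linarith

end Morse

/-! ### Quasiconvex subgroups: finite generation and traces on factors -/

section Quasiconvex

open SimpleGraph

variable {G : Type*} [Group G] {A B : Set G}

theorem IsQuasiconvexWith.exists_nat {Q : Set G} (h : IsQuasiconvexWith A Q) :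
    ∃ N : ℕ, ∀ u ∈ Q, ∀ v ∈ Q, ∀ p : (mulCayley A).Walk u v,
      p.length = (mulCayley A).dist u v → ∀ x ∈ p.support, ∃ q ∈ Q, (mulCayley A).dist x q ≤ N := by
  obtain ⟨η, -, h⟩ := h
  refine ⟨⌈η⌉₊, fun u hu v hv p hp x hx => ?_⟩
  obtain ⟨q, hq, hxq⟩ := h u hu v hv p hp x hx
  exact ⟨q, hq, Nat.cast_le.1 (hxq.trans (Nat.le_ceil η))⟩

/-- Shadow a geodesic from 1 to g by elements of H within N: consecutive shadows are at most `2 * N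
+ 1` apart. -/
theorem IsQuasiconvexWith.exists_finite_closure_eq (hA : IsFiniteSymmGenSet A) {H : Subgroup G}
    (h : IsQuasiconvexWith A (H : Set G)) : ∃ F : Set G, F.Finite ∧ Subgroup.closure F = H := by
  obtain ⟨N, hN⟩ := h.exists_nat
  set F : Set G := {x | (mulCayley A).dist 1 x ≤ 2 * N + 1} ∩ H
  refine ⟨F, (hA.finite_ball _).inter_of_left _, le_antisymm ?_ fun g hg => ?_⟩
  · exact (Subgroup.closure_le _).2 Set.inter_subset_right
  have hFH : Subgroup.closure F ≤ H := (Subgroup.closure_le _).2 Set.inter_subset_right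
  obtain ⟨p, hp⟩ := hA.connected.exists_walk_length_eq_dist 1 g
  have step : ∀ q ∈ Subgroup.closure F, ∀ q' ∈ H, (mulCayley A).dist q q' ≤ 2 * N + 1 →
      q' ∈ Subgroup.closure F := by
    intro q hq q' hq' hd
    rw [hA.dist_eq_dist_one] at hd
    have : q⁻¹ * q' ∈ Subgroup.closure F :=
      Subgroup.subset_closure ⟨hd, H.mul_mem (H.inv_mem (hFH hq)) hq'⟩
    simpa using mul_mem hq this
  have key : ∀ i ≤ p.length, ∃ q ∈ Subgroup.closure F,
      (mulCayley A).dist (p.getVert i) q ≤ N := by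
    intro i
    induction i with
    | zero => exact fun _ => ⟨1, one_mem _, by simp⟩
    | succ i ih =>
      intro hi
      obtain ⟨q, hq, hd⟩ := ih (by omega)
      obtain ⟨q', hq', hd'⟩ := hN 1 H.one_mem g hg p hp _ (p.getVert_mem_support (i + 1))
      refine ⟨q', step q hq q' hq' ?_, hd'⟩
      have h1 := p.dist_getVert_le (Nat.le_succ i)
      have h2 : (mulCayley A).dist q q' ≤
        (mulCayley A).dist q (p.getVert i) + (mulCayley A).dist (p.getVert i) q' :=
          hA.connected.dist_triangle
      have h3 : (mulCayley A).dist (p.getVert i) q' ≤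
        (mulCayley A).dist (p.getVert i) (p.getVert (i + 1)) +
          (mulCayley A).dist (p.getVert (i + 1)) q' := hA.connected.dist_triangle
      rw [SimpleGraph.dist_comm (u := q) (v := p.getVert i)] at h2
      simp only [Nat.succ_eq_add_one] at h1
      omega
  obtain ⟨q, hq, hd⟩ := key p.length le_rfl
  rw [p.getVert_length, SimpleGraph.dist_comm] at hd
  exact step q hq g hg (by omega)

/-- If `H` is quasiconvex with respect to any generating set of a group that is hyperbolic with
respect to `B`, then the preimage of a conjugate of `H` under an isometrically embedded group is
quasiconvex. -/
theorem IsQuasiconvexWith.comap_conj (hA : IsFiniteSymmGenSet A) (hB : IsFiniteSymmGenSet B)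
    {δ : ℝ} (hδ : 0 ≤ δ) (hF : ∀ x y z w, FourPoint (mulCayley B).dist δ x y z w)
    {H : Subgroup G} (h : IsQuasiconvexWith A (H : Set G)) {P : Type*} [Group P] {A' : Set P}
    (hA' : IsFiniteSymmGenSet A') (φ : P →* G)
    (hφ : ∀ u v, (mulCayley B).dist (φ u) (φ v) = (mulCayley A').dist u v) (w : G) :
    IsQuasiconvexWith A' {k : P | w⁻¹ * φ k * w ∈ H} := by
  obtain ⟨N, hN⟩ := h.exists_nat
  obtain ⟨L, hL⟩ := hA.exists_forall_dist_le hB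
  obtain ⟨C, hC⟩ := hB.exists_forall_dist_le hA
  have tri : ∀ x y z, (mulCayley B).dist x z ≤ (mulCayley B).dist x y + (mulCayley B).dist y z :=
    fun _ _ _ => hB.connected.dist_triangle
  obtain ⟨D, hD⟩ := FourPoint.exists_dist_le_of_quasigeodesic (fun _ => SimpleGraph.dist_self)
    (fun _ _ => SimpleGraph.dist_comm) tri hδ hF C (max L ((mulCayley B).dist 1 w))
  -- One representative in P is fixed for each coset `wHy` that meets the image. If `φ x` and `φ (f
  -- y)` both lie in `wHy`, then `x * (f y)⁻¹` lies in the subgroup, at distance `|f y|` from `x`.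
  -- Only finitely many y arise.
  have hrep : ∀ y, ∃ g : P, (∃ g', ∃ h ∈ H, φ g' = w * h * y) → ∃ h ∈ H, φ g = w * h * y := by
    intro y
    by_cases hy : ∃ g', ∃ h ∈ H, φ g' = w * h * y
    · exact ⟨hy.choose, fun _ => hy.choose_spec⟩
    · exact ⟨1, fun h => absurd h hy⟩
  choose f hf using hrep
  obtain ⟨M, hM⟩ := ((hB.finite_ball (D + L * N)).image
    fun y => (mulCayley A').dist (f y) 1).bddAbove
  refine ⟨M, Nat.cast_nonneg M, fun u hu v hv p hp x hx => ?_⟩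
  obtain ⟨s, rfl, hs⟩ := Walk.mem_support_iff_exists_getVert.1 hx
  -- Quasiconvexity of H concerns `A`-geodesics; translated by w, such a geodesic is a
  -- `B`-quasigeodesic from `φ u * w` to `φ v * w`.
  obtain ⟨q, hq⟩ := hA.connected.exists_walk_length_eq_dist (w⁻¹ * φ u * w) (w⁻¹ * φ v * w)
  obtain ⟨j, hj, hdj⟩ := hD p.length q.length (fun i => φ (p.getVert i)) (fun i => w * q.getVert i)
    (fun i j hij hj => by rw [hφ, p.dist_getVert_of_geodesic hA'.connected hp hij hj])
    (fun i hi => by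
      rw [hB.dist_mul_left]
      refine (hL _ _).trans (le_max_of_le_left ?_)
      have := Nat.mul_le_mul_left L (q.dist_getVert_le (Nat.le_succ i))
      simpa using this)
    (fun i j hij hj => by
      rw [hB.dist_mul_left, ← q.dist_getVert_of_geodesic hA.connected hq hij hj]
      exact hC _ _)
    (by
      refine le_max_of_le_right ?_
      rw [p.getVert_zero, q.getVert_zero, hB.dist_eq_dist_one]
      group
      exact le_rfl)
    (by
      refine le_max_of_le_right ?_
      rw [p.getVert_length, q.getVert_length, hB.dist_eq_dist_one]
      group
      exact le_rfl) s hs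
  obtain ⟨h, hh, hqh⟩ := hN _ hu _ hv q hq _ (q.getVert_mem_support j)
  set x := p.getVert s
  set y := (w * h)⁻¹ * φ x with hy
  have hxy : φ x = w * h * y := by rw [hy]; group
  have hyD : (mulCayley B).dist 1 y ≤ D + L * N := by
    rw [hy, ← hB.dist_eq_dist_one, SimpleGraph.dist_comm]
    refine (tri _ (w * q.getVert j) _).trans (add_le_add hdj ?_)
    rw [hB.dist_mul_left]
    exact (hL _ _).trans (Nat.mul_le_mul_left L hqh)
  obtain ⟨h', hh', hfy⟩ := hf y ⟨x, h, hh, hxy⟩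
  refine ⟨x * (f y)⁻¹, ?_, ?_⟩
  · change w⁻¹ * φ (x * (f y)⁻¹) * w ∈ H
    have : w⁻¹ * φ (x * (f y)⁻¹) * w = h * h'⁻¹ := by
      rw [map_mul, map_inv, hfy, hxy]
      group
    rw [this]
    exact H.mul_mem hh (H.inv_mem hh')
  · have h1 : (mulCayley A').dist x (x * (f y)⁻¹) = (mulCayley A').dist (f y) 1 := by
      rw [← hA'.dist_mul_left (f y * x⁻¹)]
      simp
    rw [wordDist, h1]
    exact_mod_cast hM ⟨y, hyD, rfl⟩

end Quasiconvex

/-! ### Open and closed sets of the profinite topology -/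

section Profinite

variable {G : Type*} [Group G]

theorem exists_normal_smul_subset_of_isOpen {U : Set G} (hU : IsOpen[profiniteTopology G] U) :
    ∀ a ∈ U, ∃ N : Subgroup G, N.Normal ∧ N.FiniteIndex ∧ ∀ n ∈ N, a * n ∈ U := by
  induction hU with
  | basic V hV =>
    obtain ⟨N, hN, hN', g, rfl⟩ := hV
    rintro a ⟨b, hb, rfl⟩
    refine ⟨N, hN, hN', fun n hn => ⟨b * n, N.mul_mem hb hn, ?_⟩⟩
    simp [mul_assoc]
  | univ => exact fun a _ => ⟨⊤, inferInstance, inferInstance, fun _ _ => trivial⟩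
  | inter V W _ _ hV hW =>
    rintro a ⟨haV, haW⟩
    obtain ⟨N, hN, hN', h⟩ := hV a haV
    obtain ⟨M, hM, hM', h'⟩ := hW a haW
    exact ⟨N ⊓ M, inferInstance, inferInstance, fun n hn => ⟨h n hn.1, h' n hn.2⟩⟩
  | sUnion 𝒱 _ h𝒱 =>
    rintro a ⟨V, hV, haV⟩
    obtain ⟨N, hN, hN', h⟩ := h𝒱 V hV a haV
    exact ⟨N, hN, hN', fun n hn => ⟨V, hV, h n hn⟩⟩

theorem isClosed_profiniteTopology_of_forall_notMem {H : Subgroup G}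
    (h : ∀ g ∉ H, ∃ M : Subgroup G, M.FiniteIndex ∧ H ≤ M ∧ g ∉ M) :
    IsClosed[profiniteTopology G] (H : Set G) := by
  let := profiniteTopology G
  refine ⟨isOpen_iff_forall_mem_open.2 fun g hg => ?_⟩
  obtain ⟨M, hM, hHM, hgM⟩ := h g hg
  refine ⟨g • (M.normalCore : Set G), ?_, TopologicalSpace.isOpen_generateFrom_of_mem
    ⟨M.normalCore, inferInstance, inferInstance, g, rfl⟩, ⟨1, one_mem _, by simp⟩⟩
  rintro _ ⟨n, hn, rfl⟩ hgn
  exact hgM ((M.mul_mem_cancel_right (M.normalCore_le hn)).1 (hHM hgn))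

end Profinite

/-! ### Replacing actions by actions of finite support -/

section FiniteActions

variable {G Ω : Type*} [Group G] [MulAction G Ω]

/-- If point stabilizers are closed in the profinite topology, then the points of a finite set lie
in distinct orbits of some normal subgroup of finite index. -/
theorem exists_normal_finiteIndex_orbit_injOn
    (hcl : ∀ ω : Ω, IsClosed[profiniteTopology G] (MulAction.stabilizer G ω : Set G)) {S : Set Ω}
    (hS : S.Finite) : ∃ N : Subgroup G, N.Normal ∧ N.FiniteIndex ∧
      ∀ s ∈ S, ∀ s' ∈ S, s' ∈ MulAction.orbit N s → s' = s := by
  have pair : ∀ t : S × S, ∃ N : Subgroup G, N.Normal ∧ N.FiniteIndex ∧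
      ((t.2 : Ω) ∈ MulAction.orbit N (t.1 : Ω) → t.2 = t.1) := by
    rintro ⟨⟨s, hs⟩, ⟨s', hs'⟩⟩
    by_cases h : ∃ a : G, a • s = s' ∧ s' ≠ s
    · obtain ⟨a, rfl, hne⟩ := h
      have ha : a⁻¹ ∈ (MulAction.stabilizer G s : Set G)ᶜ := fun h => by
        have := (MulAction.stabilizer G s).inv_mem h
        rw [inv_inv] at this
        exact hne this
      -- If `n • s = a • s`, then `a⁻¹ * n` stabilizes s; so N is chosen with `a⁻¹N` disjoint from
      -- the stabilizer.
      obtain ⟨N, hN, hN', hd⟩ := exists_normal_smul_subset_of_isOpen (hcl s).isOpen_compl _ ha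
      refine ⟨N, hN, hN', ?_⟩
      rintro ⟨n, hn⟩
      refine absurd ?_ (hd n n.2)
      change (a⁻¹ * (n : G)) • s = s
      have hn' : (n : G) • s = a • s := hn
      rw [mul_smul, hn', inv_smul_smul]
    · refine ⟨⊤, inferInstance, inferInstance, ?_⟩
      rintro ⟨n, hn⟩
      by_contra hne
      exact h ⟨n, hn, fun e => hne (Subtype.ext e)⟩
  choose N hN hN' hNs using pair
  have := hS.to_subtype
  refine ⟨⨅ t, N t, Subgroup.normal_iInf_normal hN, Subgroup.finiteIndex_iInf hN', ?_⟩
  rintro s hs s' hs' ⟨n, hn⟩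
  have hn' := (Subgroup.mem_iInf.1 n.2) (⟨s, hs⟩, ⟨s', hs'⟩)
  exact congrArg Subtype.val (hNs (⟨s, hs⟩, ⟨s', hs'⟩) ⟨⟨n, hn'⟩, hn⟩)

/-- If point stabilizers are closed in the profinite topology, then every action agrees on a given
finite set with an action of finite support. -/
theorem exists_finite_support_action
    (hcl : ∀ ω : Ω, IsClosed[profiniteTopology G] (MulAction.stabilizer G ω : Set G)) {S : Set Ω}
    (hS : S.Finite) : ∃ (ρ : G →* Equiv.Perm Ω) (X : Set Ω), X.Finite ∧
      (∀ a, ∀ ω ∉ X, ρ a ω = ω) ∧ ∀ s ∈ S, ∀ a : G, a • s ∈ S → ρ a s = a • s := by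
  obtain ⟨N, hN, hN', hNS⟩ := exists_normal_finiteIndex_orbit_injOn hcl hS
  -- As N is normal, G permutes the N-orbits, and it does so through the finite quotient G/N.
  let T : SubMulAction G (Set Ω) :=
    { carrier := ⋃ s ∈ S, MulAction.orbit G (MulAction.orbit N s : Set Ω)
      smul_mem' := by
        intro a t ht
        simp only [Set.mem_iUnion] at ht ⊢
        obtain ⟨s, hs, ht⟩ := ht
        exact ⟨s, hs, (MulAction.mem_orbit_of_mem_orbit a ht)⟩ }
  have hTfin : (T : Set (Set Ω)).Finite := by
    refine hS.biUnion fun s _ => ?_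
    have hle : N ≤ MulAction.stabilizer G (MulAction.orbit N s : Set Ω) := fun n hn =>
      MulAction.smul_orbit (⟨n, hn⟩ : N) s
    have : (MulAction.stabilizer G (MulAction.orbit N s : Set Ω)).FiniteIndex :=
      Subgroup.finiteIndex_of_le hle
    exact Set.finite_coe_iff.1 (Finite.of_equiv _
      (MulAction.orbitEquivQuotientStabilizer G (MulAction.orbit N s : Set Ω)).symm)
  -- A transversal passing through S, possible since an orbit contains at most one point of S. The
  -- action on `T` is carried to it and extended by the identity.
  have hrep : ∀ t : T, ∃ ω, (t : Set Ω) = MulAction.orbit N ω ∧ ∀ s ∈ S, s ∈ (t : Set Ω) → ω = s := by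
    rintro ⟨t, ht⟩
    have ht' : t ∈ ⋃ s ∈ S, MulAction.orbit G (MulAction.orbit N s : Set Ω) := ht
    simp only [Set.mem_iUnion] at ht'
    obtain ⟨s, hs, a, rfl⟩ := ht'
    have hat : (a • MulAction.orbit N s : Set Ω) = MulAction.orbit N (a • s) :=
      MulAction.smul_orbit_eq_orbit_smul N s a
    by_cases h : ∃ s' ∈ S, s' ∈ MulAction.orbit N (a • s)
    · obtain ⟨s', hs', hmem⟩ := h
      have heq := MulAction.orbit_eq_iff.2 hmem
      refine ⟨s', hat.trans heq.symm, fun s'' hs'' hmem' => ?_⟩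
      refine (hNS s' hs' s'' hs'' ?_).symm
      rw [heq, ← hat]
      exact hmem'
    · refine ⟨a • s, hat, fun s'' hs'' hmem' => absurd ⟨s'', hs'', ?_⟩ h⟩
      rw [← hat]
      exact hmem'
  choose σ hσ hσS using hrep
  have hinj : Function.Injective σ := fun t t' h => Subtype.ext (by rw [hσ t, hσ t', h])
  have := hTfin.to_subtype
  refine ⟨(Equiv.Perm.viaEmbeddingHom ⟨σ, hinj⟩).comp (MulAction.toPermHom G T), Set.range σ,
    Set.finite_range σ, fun a ω hω => Equiv.Perm.viaEmbedding_apply_of_notMem _ _ _ hω,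
    fun s hs a has => ?_⟩
  have hsT : MulAction.orbit N s ∈ T := by
    change _ ∈ ⋃ s ∈ S, MulAction.orbit G (MulAction.orbit N s : Set Ω)
    exact Set.mem_biUnion hs (MulAction.mem_orbit_self _)
  have h1 : σ ⟨_, hsT⟩ = s := hσS _ s hs (MulAction.mem_orbit_self s)
  have h2 : σ (a • ⟨_, hsT⟩) = a • s := by
    refine hσS _ _ has ?_
    change a • s ∈ a • MulAction.orbit N s
    exact Set.smul_mem_smul_set (MulAction.mem_orbit_self s)
  have h3 := Equiv.Perm.viaEmbedding_apply (MulAction.toPermHom G T a) ⟨σ, hinj⟩ ⟨_, hsT⟩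
  change Equiv.Perm.viaEmbedding _ ⟨σ, hinj⟩ (σ ⟨_, hsT⟩) = σ (a • ⟨_, hsT⟩) at h3
  rwa [h1, h2] at h3

theorem finiteIndex_comap_stabilizer {G Ω : Type*} [Group G] (ρ : G →* Equiv.Perm Ω) {Y : Set Ω}
    (hY : Y.Finite) (hρ : ∀ g, ∀ y ∈ Y, ρ g y ∈ Y) {ω : Ω} (hω : ω ∈ Y) :
    ((MulAction.stabilizer (Equiv.Perm Ω) ω).comap ρ).FiniteIndex := by
  let := MulAction.compHom Ω ρ
  have hfin : (MulAction.orbit G ω).Finite := hY.subset (by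
    rintro _ ⟨g, rfl⟩
    exact hρ g ω hω)
  have := hfin.to_subtype
  have := Finite.of_equiv _ (MulAction.orbitEquivQuotientStabilizer G ω)
  exact Subgroup.finiteIndex_of_finite_quotient (H := MulAction.stabilizer G ω)

end FiniteActions

/-! ### Separating a finitely generated subgroup of a free product -/

section Coprod

open Monoid.Coprod

variable {G₁ G₂ : Type*} [Group G₁] [Group G₂]

/-- Whether an action of a free product agrees with a given one at an element and a point is
determined by the actions of the factors on finitely many points. -/
theorem exists_finite_forall_apply_eq_smul {Ω : Type*} [MulAction (Monoid.Coprod G₁ G₂) Ω]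
    (x : Monoid.Coprod G₁ G₂) (p : Ω) : ∃ S : Set Ω, S.Finite ∧ ∀ S' ⊇ S,
      ∀ ρ : Monoid.Coprod G₁ G₂ →* Equiv.Perm Ω,
        (∀ s ∈ S', ∀ a : G₁, (inl a : Monoid.Coprod G₁ G₂) • s ∈ S' →
          ρ (inl a) s = (inl a : Monoid.Coprod G₁ G₂) • s) →
        (∀ s ∈ S', ∀ b : G₂, (inr b : Monoid.Coprod G₁ G₂) • s ∈ S' →
          ρ (inr b) s = (inr b : Monoid.Coprod G₁ G₂) • s) → ρ x p = x • p := by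
  induction x using Monoid.Coprod.induction_on generalizing p with
  | inl a => exact ⟨{p, inl a • p}, by simp, fun S' hS' ρ h _ => h p (hS' (Set.mem_insert _ _)) a
    (hS' (Set.mem_insert_of_mem _ rfl))⟩
  | inr b => exact ⟨{p, inr b • p}, by simp, fun S' hS' ρ _ h => h p (hS' (Set.mem_insert _ _)) b
    (hS' (Set.mem_insert_of_mem _ rfl))⟩
  | mul x y hx hy =>
    obtain ⟨S, hS, h⟩ := hy p
    obtain ⟨T, hT, h'⟩ := hx (y • p)
    refine ⟨S ∪ T, hS.union hT, fun S' hS' ρ h₁ h₂ => ?_⟩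
    rw [map_mul, Equiv.Perm.mul_apply, h S' (Set.subset_union_left.trans hS') ρ h₁ h₂,
      h' S' (Set.subset_union_right.trans hS') ρ h₁ h₂, mul_smul]

theorem Equiv.Perm.apply_mem_of_fixed {G Ω : Type*} [Group G] {ρ : G →* Equiv.Perm Ω} {X Y : Set Ω}
    (hX : ∀ a, ∀ ω ∉ X, ρ a ω = ω) (hXY : X ⊆ Y) (a : G) {y : Ω} (hy : y ∈ Y) : ρ a y ∈ Y := by
  by_contra h
  have h1 := hX a⁻¹ (ρ a y) fun h' => h (hXY h')
  rw [map_inv, Equiv.Perm.inv_def, Equiv.symm_apply_apply] at h1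
  exact h (h1 ▸ hy)

/-- A finitely generated subgroup of a free product is closed in the profinite topology if the
intersections of its conjugates with the factors are. -/
theorem isClosed_coprod_of_isClosed_stabilizer {H : Subgroup (Monoid.Coprod G₁ G₂)}
    {F : Set (Monoid.Coprod G₁ G₂)} (hF : F.Finite) (hFH : Subgroup.closure F = H)
    (h₁ : ∀ w, IsClosed[profiniteTopology G₁] {k : G₁ | w⁻¹ * inl k * w ∈ H})
    (h₂ : ∀ w, IsClosed[profiniteTopology G₂] {k : G₂ | w⁻¹ * inr k * w ∈ H}) :
    IsClosed[profiniteTopology (Monoid.Coprod G₁ G₂)] (H : Set (Monoid.Coprod G₁ G₂)) := by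
  refine isClosed_profiniteTopology_of_forall_notMem fun g hg => ?_
  let p₀ : Monoid.Coprod G₁ G₂ ⧸ H := ((1 : Monoid.Coprod G₁ G₂) : Monoid.Coprod G₁ G₂ ⧸ H)
  choose S hS hSρ using fun x => exists_finite_forall_apply_eq_smul (G₁ := G₁) (G₂ := G₂) x p₀
  -- Enough points to control the action of g and of the generators on the base coset.
  set S' := ⋃ x ∈ insert g F, S x with hS'
  have hS'fin : S'.Finite := (hF.insert g).biUnion fun x _ => hS x
  obtain ⟨ρ₁, X₁, hX₁, hfix₁, hag₁⟩ : ∃ (ρ : G₁ →* Equiv.Perm (Monoid.Coprod G₁ G₂ ⧸ H))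
      (X : Set (Monoid.Coprod G₁ G₂ ⧸ H)), X.Finite ∧ (∀ a, ∀ ω ∉ X, ρ a ω = ω) ∧ ∀ s ∈ S', ∀ a : G₁,
        (inl a : Monoid.Coprod G₁ G₂) • s ∈ S' → ρ a s = (inl a : Monoid.Coprod G₁ G₂) • s := by
    let := MulAction.compHom (Monoid.Coprod G₁ G₂ ⧸ H) (inl : G₁ →* Monoid.Coprod G₁ G₂)
    refine exists_finite_support_action (fun ω => ?_) hS'fin
    obtain ⟨w, rfl⟩ := QuotientGroup.mk_surjective ω
    convert h₁ w using 1
    ext k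
    change ((inl k * w : Monoid.Coprod G₁ G₂) : Monoid.Coprod G₁ G₂ ⧸ H) = w ↔ _
    rw [eq_comm, QuotientGroup.eq, Set.mem_ofPred_eq, mul_assoc]
  obtain ⟨ρ₂, X₂, hX₂, hfix₂, hag₂⟩ : ∃ (ρ : G₂ →* Equiv.Perm (Monoid.Coprod G₁ G₂ ⧸ H))
      (X : Set (Monoid.Coprod G₁ G₂ ⧸ H)), X.Finite ∧ (∀ a, ∀ ω ∉ X, ρ a ω = ω) ∧ ∀ s ∈ S', ∀ a : G₂,
        (inr a : Monoid.Coprod G₁ G₂) • s ∈ S' → ρ a s = (inr a : Monoid.Coprod G₁ G₂) • s := by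
    let := MulAction.compHom (Monoid.Coprod G₁ G₂ ⧸ H) (inr : G₂ →* Monoid.Coprod G₁ G₂)
    refine exists_finite_support_action (fun ω => ?_) hS'fin
    obtain ⟨w, rfl⟩ := QuotientGroup.mk_surjective ω
    convert h₂ w using 1
    ext k
    change ((inr k * w : Monoid.Coprod G₁ G₂) : Monoid.Coprod G₁ G₂ ⧸ H) = w ↔ _
    rw [eq_comm, QuotientGroup.eq, Set.mem_ofPred_eq, mul_assoc]
  have hρ : ∀ x ∈ insert g F, lift ρ₁ ρ₂ x p₀ = x • p₀ := fun x hx =>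
    hSρ x S' (Set.subset_biUnion_of_mem (u := S) hx) (lift ρ₁ ρ₂) hag₁ hag₂
  have hp₀ : ∀ x : Monoid.Coprod G₁ G₂, x • p₀ = p₀ ↔ x ∈ H := by
    intro x
    change ((x * 1 : Monoid.Coprod G₁ G₂) : Monoid.Coprod G₁ G₂ ⧸ H) = (1 : Monoid.Coprod G₁ G₂) ↔ _
    rw [eq_comm, QuotientGroup.eq, inv_one, one_mul, mul_one]
  -- Any set containing both supports is invariant, so the orbit of `p₀` is finite.
  have hY : ∀ x, ∀ y ∈ insert p₀ (X₁ ∪ X₂), lift ρ₁ ρ₂ x y ∈ insert p₀ (X₁ ∪ X₂) := by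
    intro x
    induction x using Monoid.Coprod.induction_on with
    | inl a =>
      exact fun y hy => Equiv.Perm.apply_mem_of_fixed hfix₁
        (Set.subset_union_left.trans (Set.subset_insert _ _)) a hy
    | inr b =>
      exact fun y hy => Equiv.Perm.apply_mem_of_fixed hfix₂
        (Set.subset_union_right.trans (Set.subset_insert _ _)) b hy
    | mul x y hx hy =>
      intro z hz
      rw [map_mul]
      exact hx _ (hy _ hz)
  refine ⟨(MulAction.stabilizer (Equiv.Perm (Monoid.Coprod G₁ G₂ ⧸ H)) p₀).comap (lift ρ₁ ρ₂),
    finiteIndex_comap_stabilizer _ ((hX₁.union hX₂).insert p₀) hY (Set.mem_insert _ _), ?_, ?_⟩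
  · refine hFH.symm.le.trans ((Subgroup.closure_le _).2 fun x hx => ?_)
    change lift ρ₁ ρ₂ x p₀ = p₀
    rw [hρ x (Set.mem_insert_of_mem _ hx), hp₀, ← hFH]
    exact Subgroup.subset_closure hx
  · intro hgM
    change lift ρ₁ ρ₂ g p₀ = p₀ at hgM
    rw [hρ g (Set.mem_insert _ _), hp₀] at hgM
    exact hg hgM

end Coprod

/-! ### The main theorem -/

theorem theorem1p5 {G₁ G₂ : Type*} [Group G₁] [Group G₂]
    (h₁ : IsGFERFHyperbolicGroup G₁) (h₂ : IsGFERFHyperbolicGroup G₂) :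
    IsGFERFHyperbolicGroup (Monoid.Coprod G₁ G₂) := by
  obtain ⟨⟨A₁, hA₁, δ₁, hδ₁, hF₁⟩, hc₁⟩ := h₁
  obtain ⟨⟨A₂, hA₂, δ₂, hδ₂, hF₂⟩, hc₂⟩ := h₂
  have hB := hA₁.coprod hA₂
  have hδ : 0 ≤ max δ₁ δ₂ := le_max_of_le_left hδ₁
  have hF := fourPoint_coprodGenSet hA₁ hA₂ hδ
    (fun x y z w => (gromovProduct_iff_fourPoint A₁ _ x y z w).1
      ((sub_le_sub_left (le_max_left _ _) _).trans (hF₁ x y z w)))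
    (fun x y z w => (gromovProduct_iff_fourPoint A₂ _ x y z w).1
      ((sub_le_sub_left (le_max_right _ _) _).trans (hF₂ x y z w)))
  refine ⟨⟨_, hB, _, hδ, fun x y z w => (gromovProduct_iff_fourPoint _ _ x y z w).2 (hF x y z w)⟩, ?_⟩
  rintro H ⟨A, hA, hH⟩
  obtain ⟨F, hFin, hFH⟩ := hH.exists_finite_closure_eq hA
  refine isClosed_coprod_of_isClosed_stabilizer hFin hFH (fun w => ?_) (fun w => ?_)
  · have hqc := hH.comap_conj hA hB hδ hF hA₁ Monoid.Coprod.inl (dist_coprodGenSet_inl hA₁ hA₂) w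
    have hK : {k : G₁ | w⁻¹ * Monoid.Coprod.inl k * w ∈ H} =
        ((H.comap (MulAut.conj w⁻¹).toMonoidHom).comap Monoid.Coprod.inl : Set G₁) := by
      ext k
      simp
    rw [hK] at hqc ⊢
    exact hc₁ _ ⟨A₁, hA₁, hqc⟩
  · have hqc := hH.comap_conj hA hB hδ hF hA₂ Monoid.Coprod.inr (dist_coprodGenSet_inr hA₁ hA₂) w
    have hK : {k : G₂ | w⁻¹ * Monoid.Coprod.inr k * w ∈ H} =
        ((H.comap (MulAut.conj w⁻¹).toMonoidHom).comap Monoid.Coprod.inr : Set G₂) := by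
      ext k
      simp
    rw [hK] at hqc ⊢
    exact hc₂ _ ⟨A₂, hA₂, hqc⟩
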